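/- A hypergraph $\mathsf H=(V,E,|\cdot|)$ consists of finite sets $V$ (vertices) and $E$ (hyperedges) and a support function $|\cdot|\colon E\to\mathcal P(V)$; for $I\subset V$ let $\mu_I=\#\{e\in E: |e|=I\}$ be its hyperedge multiplicities. For a commutative ring $R$, the incidence representation of $\mathsf H$ over $R$ is the $R$-linear map $$\eta^R\colon R\,\{(v,e)\in V\times E: v\in|e|\}\to \operatorname{Hom}_R(RV,RE),\qquad (v,e)\mapsto\bigl(u\mapsto\delta_{uv}e\bigr),$$ where $RS$ denotes the free $R$-module on a set $S$. For a module representation $\theta\colon A\to\operatorname{Hom}(B,C)$ with $A,B$ finite, let $\operatorname{ask}(\theta)=\frac1{|A|}\sum_{a\in A}|\operatorname{Ker}(a\theta)|$. For a compact discrete valuation ring $\mathfrak O$ (of any characteristic) with maximal ideal $\mathfrak P$ and $\theta$ over $\mathfrak O$ involving free modules of finite rank, let $$\mathsf Z^{\mathrm{ask}}_\theta(T)=\sum_{k=0}^\infty\operatorname{ask}\bigl(\theta\otimes_{\mathfrak O}\mathfrak O/\mathfrak P^k\bigr)T^k\in\mathbf Q[[T]].$$ The ask zeta function $W_{\mathsf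 H}(X,T)$ of $\mathsf H$ is the rational function in $\mathbf Q(X,T)$ such that $\mathsf Z^{\mathrm{ask}}_{\eta^{\mathfrak O}}(T)=W_{\mathsf H}(q,T)$ for every compact discrete valuation ring $\mathfrak O$, where $q=|\mathfrak O/\mathfrak P|$. Let $\widehat{\mathrm{WO}}(V)$ be the set of all flags $y=(I_1\subsetneq\dots\subsetneq I_\ell)$, $\ell\ge0$, of subsets of $V$ (where $I_1=\varnothing$ and $I_\ell=V$ are allowed), and let $\operatorname{rk}(y)=|\sup(y)|$ be the cardinality of the largest member of $y$, with $\operatorname{rk}(y)=0$ for the empty flag. Write $\operatorname{gp}(x)=x/(1-x)$. **Theorem.** For every hypergraph $\mathsf H$ with vertex set $V$ and hyperedge multiplicities $(\mu_I)_{I\subset V}$, the rational function $W_{\mathsf H}(X,T)$ exists, is unique, and is given by $$W_{\mathsf H}(X,T)=\sum_{y\in\widehat{\mathrm{WO}}(V)}(1-X^{-1})^{\operatorname{rk}(y)}\prod_{J\in y}\operatorname{gp}\Bigl(X^{|J|-\sum_{I\cap J\ne\varnothing}\mu_I}\,T\Bigr).$$ -/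

import Mathlib

universe u v w

namespace AskZeta

noncomputable section

open scoped TensorProduct
open Polynomial

/-! ### Hypergraphs -/

/-- A hypergraph `(V, E, |·|)` with vertex set `V`, set of hyperedges `E` and support function
`|·| : E → Pow(V)`. Hyperedges may be parallel and supports may be empty. -/
structure Hypergraph (V : Type v) (E : Type w) where
  /-- the support `|e|` of a hyperedge `e` -/
  supp : E → Finset V

namespace Hypergraph

variable {V : Type v} {E : Type w}

/-- The hyperedge multiplicity `μ_I`: the number of hyperedges with support `I`. -/
def multiplicity (H : Hypergraph V E) (I : Finset V) : ℕ :=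
  Nat.card {e : E // H.supp e = I}

/-- The set of incident pairs `(v, e)`, i.e. `v ∈ |e|`. -/
def Incident (H : Hypergraph V E) : Type (max v w) :=
  {p : V × E // p.1 ∈ H.supp p.2}

/-- The incidence representation `η^R : R I(H) → Hom(RV, RE)` of `H` over `R`. It sends an incident
pair `(v, e)` to the homomorphism `[ve] : RV → RE`, `u ↦ δ_{uv} e`, and so parameterises the
`V × E` matrices (acting on row vectors) whose `(v, e)` entry vanishes unless `v ∈ |e|`. -/
def incidenceRep (H : Hypergraph V E) (R : Type u) [CommRing R] :
    (H.Incident →₀ R) →ₗ[R] (V →₀ R) →ₗ[R] (E →₀ R) :=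
  Finsupp.linearCombination R fun p : H.Incident =>
    (Finsupp.lsingle p.1.2 : R →ₗ[R] (E →₀ R)) ∘ₗ (Finsupp.lapply p.1.1 : (V →₀ R) →ₗ[R] R)

end Hypergraph

/-! ### Ask zeta functions -/

section Ask

variable {R : Type*} [CommRing R]
variable {A B C : Type*} [AddCommGroup A] [Module R A] [AddCommGroup B] [Module R B]
  [AddCommGroup C] [Module R C]

/-- The base change `θ^S : S ⊗ A → Hom(S ⊗ B, S ⊗ C)` of a module representation
`θ : A → Hom(B, C)`, characterised by `(s ⊗ a) θ^S = s · (id_S ⊗ aθ)`. -/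
def repBaseChange (S : Type*) [CommRing S] [Algebra R S] (θ : A →ₗ[R] B →ₗ[R] C) :
    (S ⊗[R] A) →ₗ[S] (S ⊗[R] B) →ₗ[S] (S ⊗[R] C) :=
  (LinearMap.tensorProduct R S B C) ∘ₗ (θ.baseChange S)

/-- The average size of the kernel of a module representation `θ : A → Hom(B, C)`
(for `A` and `B` finite). -/
def ask (θ : A →ₗ[R] B →ₗ[R] C) : ℚ :=
  (∑ᶠ a : A, (Nat.card (LinearMap.ker (θ a)) : ℚ)) / (Nat.card A : ℚ)

end Ask

/-- The (algebraic) ask zeta function `∑ₖ ask(θ ⊗ 𝔒/𝔓ᵏ) Tᵏ` of a module representation `θ` over a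
local ring `𝔒` (a compact discrete valuation ring below) with maximal ideal `𝔓`. -/
def askZeta {O : Type*} [CommRing O] [IsLocalRing O]
    {A B C : Type*} [AddCommGroup A] [Module O A] [AddCommGroup B] [Module O B]
    [AddCommGroup C] [Module O C] (θ : A →ₗ[O] B →ₗ[O] C) : PowerSeries ℚ :=
  PowerSeries.mk fun k => ask (repBaseChange (O ⧸ IsLocalRing.maximalIdeal O ^ k) θ)

/-! ### Rational functions in two variables -/

/-- The field `ℚ(X, T)`, as the field of fractions of `ℚ[X][T]`. -/
abbrev RatFun2 : Type := FractionRing ℚ[X][X]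

/-- The variable `X` of `ℚ(X, T)`. -/
def varX : RatFun2 := algebraMap ℚ[X][X] RatFun2 (Polynomial.C Polynomial.X)

/-- The variable `T` of `ℚ(X, T)`. -/
def varT : RatFun2 := algebraMap ℚ[X][X] RatFun2 Polynomial.X

/-- The polynomial `f(q, T)` for `f(X, T) ∈ ℚ[X, T]`. -/
def evalX (q : ℚ) (f : ℚ[X][X]) : ℚ[X] := f.map (Polynomial.evalRingHom q)

/-- `W(q, T) = Z(T)` for `W(X, T) ∈ ℚ(X, T)` and `Z(T) ∈ ℚ⟦T⟧`: the rational function `W` can be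
written as `a / b` with `a, b ∈ ℚ[X, T]` and `b(q, T) ≠ 0` (so that `W(q, T) ∈ ℚ(T)` is defined and
equal to `a(q, T) / b(q, T)`), and `b(q, T) Z(T) = a(q, T)`. -/
def SpecializesTo (W : RatFun2) (q : ℚ) (Z : PowerSeries ℚ) : Prop :=
  ∃ a b : ℚ[X][X], evalX q b ≠ 0 ∧
    W = algebraMap ℚ[X][X] RatFun2 a / algebraMap ℚ[X][X] RatFun2 b ∧
    (evalX q b : PowerSeries ℚ) * Z = (evalX q a : PowerSeries ℚ)

/-- `W(X, T) ∈ ℚ(X, T)` is the ask zeta function `W_H(X, T)` of the hypergraph `H`: for every compact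
discrete valuation ring `𝔒` (a discrete valuation ring which is compact in its `𝔓`-adic
topology), of any characteristic and with residue field size `q`, the ask zeta function of the
incidence representation of `H` over `𝔒` is `W(q, T)`. -/
def Hypergraph.IsAskZetaFunction {V : Type v} {E : Type w} (H : Hypergraph V E) (W : RatFun2) :
    Prop :=
  ∀ (O : Type u) [CommRing O] [IsDomain O] [IsDiscreteValuationRing O]
    [TopologicalSpace O] [CompactSpace O], IsAdic (IsLocalRing.maximalIdeal O) →
    SpecializesTo W (Nat.card (IsLocalRing.ResidueField O) : ℚ) (askZeta (H.incidenceRep O))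

/-! ### Flags of subsets -/

section Flags

variable (V : Type v) [Fintype V]

open Classical in
/-- `WO^(V)`: all flags `I₁ ⊊ ⋯ ⊊ I_ℓ` (`ℓ ≥ 0`) of subsets of `V`, where a flag is regarded as the
set `{I₁, …, I_ℓ}` of its members. Both `∅` and `V` may be members. -/
def flags : Finset (Finset (Finset V)) :=
  Finset.univ.filter fun y => IsChain (· ⊆ ·) (y : Set (Finset V))

end Flags

/-- The rank `|sup y|` of a flag `y`, i.e. the size of its largest member; the empty flag has
rank `0`. -/
def flagRank {V : Type v} [DecidableEq V] (y : Finset (Finset V)) : ℕ := (y.sup id).card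

/-- `gp(x) = x / (1 - x)`. -/
def gp {K : Type*} [Field K] (x : K) : K := x / (1 - x)

end

end AskZeta

namespace AskZeta

noncomputable section

open scoped TensorProduct
open Polynomial

/-! ### Specialisation of rational functions -/

section Specialization

variable {q : ℚ} {W W' : RatFun2} {Z Z' : PowerSeries ℚ}

/-! Counting pairs (a, x) with x(aθ) = 0 in two ways turns ask(θ) into the sum over x of 1/|xA|,
where xA is the orbit of x (`ask_eq_sum_inv_card_range`). For the incidence representation over R =
𝔒/𝔓ᵏ, the orbit of x is a product, over hyperedges e, of the ideals generated by the x_v with v ∈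
|e| (`card_range_incidenceRep_flip`).

The ideals of R form a chain with sizes 1, q, …, qᵏ. Put m(v) = log_q |x_v R|, so 0 ≤ m(v) ≤ k. The
summand at x is q to the power −∑_e max_{|e|} m, and the number of x with given m is (1 − 1/q)^{#{m
≥ 1}} q^{∑ m}. Both exponents of q are sums over the level sets J = {m ≥ i}, 1 ≤ i ≤ k, and together
each level contributes |J| − #{e : |e| ∩ J ≠ ∅} (`IsChainOfIdeals.ask_incidenceRep`).

Finally, m amounts to its decreasing sequence of k level sets, that is, to a flag with positive
multiplicities of total k. Such data index the Tᵏ-coefficients of the products of geometric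
progressions, and the union of the flag is {m ≥ 1} (`coeff_sum_flags`).

Uniqueness holds because the p-adic integers realise infinitely many values of q
(`eq_of_specializesTo`). -/

@[simp] lemma evalX_one : evalX q 1 = 1 := by simp [evalX]

@[simp] lemma evalX_C (f : ℚ[X]) : evalX q (C f) = C (f.eval q) := by simp [evalX]

@[simp] lemma evalX_X : evalX q X = X := by simp [evalX]

@[simp] lemma evalX_add (f g : ℚ[X][X]) : evalX q (f + g) = evalX q f + evalX q g := by
  simp [evalX]

@[simp] lemma evalX_sub (f g : ℚ[X][X]) : evalX q (f - g) = evalX q f - evalX q g := by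
  simp [evalX]

@[simp] lemma evalX_mul (f g : ℚ[X][X]) : evalX q (f * g) = evalX q f * evalX q g := by
  simp [evalX]

lemma ne_zero_of_evalX_ne_zero {b : ℚ[X][X]} (h : evalX q b ≠ 0) :
    algebraMap ℚ[X][X] RatFun2 b ≠ 0 := by
  rw [Ne, FaithfulSMul.algebraMap_eq_zero_iff]
  rintro rfl
  simp [evalX] at h

lemma SpecializesTo.one : SpecializesTo 1 q 1 := ⟨1, 1, by simp, by simp, by simp⟩

lemma SpecializesTo.zero : SpecializesTo 0 q 0 := ⟨0, 1, by simp, by simp, by simp [evalX]⟩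

lemma SpecializesTo.add (h : SpecializesTo W q Z) (h' : SpecializesTo W' q Z') :
    SpecializesTo (W + W') q (Z + Z') := by
  obtain ⟨a, b, hb, rfl, hZ⟩ := h
  obtain ⟨a', b', hb', rfl, hZ'⟩ := h'
  refine ⟨a * b' + b * a', b * b', by simp [hb, hb'], ?_, ?_⟩
  · rw [div_add_div _ _ (ne_zero_of_evalX_ne_zero hb) (ne_zero_of_evalX_ne_zero hb')]
    simp
  · simp only [evalX_add, evalX_mul, Polynomial.coe_add, Polynomial.coe_mul]
    linear_combination (evalX q b' : PowerSeries ℚ) * hZ + (evalX q b : PowerSeries ℚ) * hZ'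

lemma SpecializesTo.mul (h : SpecializesTo W q Z) (h' : SpecializesTo W' q Z') :
    SpecializesTo (W * W') q (Z * Z') := by
  obtain ⟨a, b, hb, rfl, hZ⟩ := h
  obtain ⟨a', b', hb', rfl, hZ'⟩ := h'
  refine ⟨a * a', b * b', by simp [hb, hb'], by simp [div_mul_div_comm], ?_⟩
  simp only [evalX_mul, Polynomial.coe_mul, ← hZ, ← hZ']
  ring

lemma SpecializesTo.neg (h : SpecializesTo W q Z) : SpecializesTo (-W) q (-Z) := by
  obtain ⟨a, b, hb, rfl, hZ⟩ := h
  refine ⟨0 - a, b, hb, by simp [neg_div], ?_⟩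
  rw [evalX_sub, Polynomial.coe_sub, ← hZ]
  simp [evalX]

lemma SpecializesTo.sub (h : SpecializesTo W q Z) (h' : SpecializesTo W' q Z') :
    SpecializesTo (W - W') q (Z - Z') := by
  simpa only [sub_eq_add_neg] using h.add h'.neg

lemma SpecializesTo.pow (h : SpecializesTo W q Z) (n : ℕ) :
    SpecializesTo (W ^ n) q (Z ^ n) := by
  induction n with
  | zero => simpa using SpecializesTo.one
  | succ n ih => simpa only [pow_succ] using ih.mul h

lemma SpecializesTo.sum {ι : Type*} (s : Finset ι) {F : ι → RatFun2} {G : ι → PowerSeries ℚ}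
    (h : ∀ i ∈ s, SpecializesTo (F i) q (G i)) :
    SpecializesTo (∑ i ∈ s, F i) q (∑ i ∈ s, G i) := by
  classical
  induction s using Finset.induction_on with
  | empty => simpa using SpecializesTo.zero
  | insert i s hi ih =>
    rw [Finset.sum_insert hi, Finset.sum_insert hi]
    exact (h i (by simp)).add (ih fun j hj => h j (by simp [hj]))

lemma SpecializesTo.prod {ι : Type*} (s : Finset ι) {F : ι → RatFun2} {G : ι → PowerSeries ℚ}
    (h : ∀ i ∈ s, SpecializesTo (F i) q (G i)) :
    SpecializesTo (∏ i ∈ s, F i) q (∏ i ∈ s, G i) := by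
  classical
  induction s using Finset.induction_on with
  | empty => simpa using SpecializesTo.one
  | insert i s hi ih =>
    rw [Finset.prod_insert hi, Finset.prod_insert hi]
    exact (h i (by simp)).mul (ih fun j hj => h j (by simp [hj]))

lemma specializesTo_varT : SpecializesTo varT q PowerSeries.X :=
  ⟨X, 1, by simp, by simp [varT], by simp⟩

lemma specializesTo_varX : SpecializesTo varX q (PowerSeries.C q) :=
  ⟨C X, 1, by simp, by simp [varX], by simp⟩

lemma specializesTo_varX_inv (hq : q ≠ 0) : SpecializesTo varX⁻¹ q (PowerSeries.C q⁻¹) := by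
  refine ⟨1, C X, by simpa using hq, by simp [varX], ?_⟩
  simp [← map_mul, hq]

lemma specializesTo_varX_zpow (hq : q ≠ 0) (n : ℤ) :
    SpecializesTo (varX ^ n) q (PowerSeries.C (q ^ n)) := by
  cases n with
  | ofNat n => simpa using specializesTo_varX.pow n
  | negSucc n =>
    have h := (specializesTo_varX_inv hq).pow (n + 1)
    rwa [inv_pow, ← map_pow, inv_pow, ← zpow_negSucc, ← zpow_negSucc] at h

/-- If W = a/b then gp(W) = a/(b − a). The new denominator survives at q: otherwise Z = 1, and `hZ'`
would give Z = 0. -/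
lemma SpecializesTo.gp (h : SpecializesTo W q Z) (hZ' : Z' * (1 - Z) = Z) :
    SpecializesTo (gp W) q Z' := by
  obtain ⟨a, b, hb, rfl, hZ⟩ := h
  have hb' : (evalX q b : PowerSeries ℚ) ≠ 0 := by simpa using hb
  have hab : evalX q (b - a) ≠ 0 := by
    intro h0
    rw [evalX_sub] at h0
    have h1 : (evalX q b : PowerSeries ℚ) * (1 - Z) = 0 := by
      rw [mul_sub, mul_one, hZ, ← Polynomial.coe_sub, h0, Polynomial.coe_zero]
    have h2 : 1 - Z = 0 := (mul_eq_zero.mp h1).resolve_left hb'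
    have h3 : Z = 0 := by rw [← hZ', h2, mul_zero]
    simp [h3] at h2
  refine ⟨a, b - a, hab, ?_, ?_⟩
  · have h1 := ne_zero_of_evalX_ne_zero hb
    have h2 := ne_zero_of_evalX_ne_zero hab
    rw [map_sub] at h2 ⊢
    rw [AskZeta.gp, one_sub_div h1, div_div_div_cancel_right₀ h1]
  · rw [evalX_sub, Polynomial.coe_sub, ← hZ]
    linear_combination (evalX q b : PowerSeries ℚ) * hZ'

/-- The power series `gp(cT) = ∑_{n ≥ 1} cⁿ Tⁿ`. -/
def gpSeries (c : ℚ) : PowerSeries ℚ := PowerSeries.mk fun n => if n = 0 then 0 else c ^ n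

lemma gpSeries_mul_one_sub (c : ℚ) :
    gpSeries c * (1 - PowerSeries.C c * PowerSeries.X) = PowerSeries.C c * PowerSeries.X := by
  ext n
  rw [mul_sub, mul_one, ← mul_assoc, map_sub]
  cases n with
  | zero => simp [gpSeries]
  | succ n =>
    rw [PowerSeries.coeff_succ_mul_X, PowerSeries.coeff_succ_mul_X, PowerSeries.coeff_mul_C,
      PowerSeries.coeff_C, gpSeries, PowerSeries.coeff_mk, PowerSeries.coeff_mk]
    cases n with
    | zero => simp
    | succ n => simp [pow_succ]

lemma specializesTo_gp_varX_zpow_mul_varT (hq : q ≠ 0) (n : ℤ) :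
    SpecializesTo (gp (varX ^ n * varT)) q (gpSeries (q ^ n)) :=
  ((specializesTo_varX_zpow hq n).mul specializesTo_varT).gp (gpSeries_mul_one_sub _)

/-- Transfers the defining identity from the one fraction supplied by `SpecializesTo` to any other,
even one whose denominator vanishes at q. -/
lemma SpecializesTo.evalX_mul_eq {a b : ℚ[X][X]} (hb : algebraMap ℚ[X][X] RatFun2 b ≠ 0)
    (h : SpecializesTo (algebraMap ℚ[X][X] RatFun2 a / algebraMap ℚ[X][X] RatFun2 b) q Z) :
    (evalX q b : PowerSeries ℚ) * Z = (evalX q a : PowerSeries ℚ) := by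
  obtain ⟨a', b', hb', h, hZ⟩ := h
  rw [div_eq_div_iff hb (ne_zero_of_evalX_ne_zero hb'), ← map_mul, ← map_mul,
    (FaithfulSMul.algebraMap_injective ℚ[X][X] RatFun2).eq_iff] at h
  have h1 := congrArg (fun f => (evalX q f : PowerSeries ℚ)) h
  simp only [evalX_mul, Polynomial.coe_mul] at h1
  have hb'' : (evalX q b' : PowerSeries ℚ) ≠ 0 := by simpa using hb'
  apply mul_left_cancel₀ hb''
  linear_combination (evalX q b : PowerSeries ℚ) * hZ - h1

/-- Each T-coefficient is a polynomial in X with infinitely many roots. -/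
lemma eq_zero_of_evalX_eq_zero {f : ℚ[X][X]} {S : Set ℚ} (hS : S.Infinite)
    (h : ∀ q ∈ S, evalX q f = 0) : f = 0 := by
  ext1 n
  refine Polynomial.eq_zero_of_infinite_isRoot _ (hS.mono fun q hq => ?_)
  simpa [evalX] using congrArg (fun g => g.coeff n) (h q hq)

/-- A rational function in `ℚ(X, T)` is determined by its specialisations at infinitely many `q`. -/
theorem eq_of_specializesTo {S : Set ℚ} (hS : S.Infinite)
    (h : ∀ q ∈ S, ∃ Z, SpecializesTo W q Z ∧ SpecializesTo W' q Z) : W = W' := by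
  obtain ⟨a, b, hb, rfl⟩ := IsFractionRing.div_surjective (A := ℚ[X][X]) W
  obtain ⟨a', b', hb', rfl⟩ := IsFractionRing.div_surjective (A := ℚ[X][X]) W'
  have hb := IsFractionRing.to_map_ne_zero_of_mem_nonZeroDivisors (K := RatFun2) hb
  have hb' := IsFractionRing.to_map_ne_zero_of_mem_nonZeroDivisors (K := RatFun2) hb'
  rw [div_eq_div_iff hb hb', ← map_mul, ← map_mul]
  congr 1
  rw [← sub_eq_zero]
  refine eq_zero_of_evalX_eq_zero hS fun q hq => ?_
  obtain ⟨Z, h1, h2⟩ := h q hq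
  have h1 := h1.evalX_mul_eq hb
  have h2 := h2.evalX_mul_eq hb'
  rw [← Polynomial.coe_eq_zero_iff]
  simp only [evalX_sub, evalX_mul, Polynomial.coe_sub, Polynomial.coe_mul, ← h1, ← h2]
  ring

end Specialization

/-! ### Level sets and flags -/

section LevelSets

variable {V : Type v} [Fintype V]

/-- The superlevel set `{v : i ≤ m v}`. -/
def levelSet (m : V → ℕ) (i : ℕ) : Finset V := Finset.univ.filter fun v => i ≤ m v

@[simp] lemma mem_levelSet {m : V → ℕ} {i : ℕ} {v : V} : v ∈ levelSet m i ↔ i ≤ m v := by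
  simp [levelSet]

lemma levelSet_antitone (m : V → ℕ) : Antitone (levelSet m) := fun i j hij v hv => by
  rw [mem_levelSet] at hv ⊢
  exact hij.trans hv

variable [DecidableEq V]

/-- The number of `i ∈ {1, …, k}` for which a given set is the superlevel set of `m` at `i`. -/
def levelCount (k : ℕ) (m : V → ℕ) : Finset V →₀ ℕ :=
  Finsupp.equivFunOnFinite.symm fun J => ((Finset.Icc 1 k).filter fun i => levelSet m i = J).card

lemma levelCount_apply (k : ℕ) (m : V → ℕ) (J : Finset V) :
    levelCount k m J = ((Finset.Icc 1 k).filter fun i => levelSet m i = J).card := rfl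

/-- The function `v ↦ ∑_{J ∋ v} c J` attached to a family of multiplicities `c`. -/
def height (c : Finset V →₀ ℕ) (v : V) : ℕ := ∑ J : Finset V with v ∈ J, c J

lemma sum_levelCount (k : ℕ) (m : V → ℕ) : ∑ J, levelCount k m J = k := by
  simp only [levelCount_apply]
  rw [← Finset.card_eq_sum_card_fiberwise (fun _ _ => by simp)]
  simp

lemma prod_pow_levelCount {M : Type*} [CommMonoid M] (k : ℕ) (m : V → ℕ) (g : Finset V → M) :
    ∏ J, g J ^ levelCount k m J = ∏ i ∈ Finset.Icc 1 k, g (levelSet m i) := by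
  rw [← Finset.prod_fiberwise (Finset.Icc 1 k) (levelSet m)]
  refine Finset.prod_congr rfl fun J _ => ?_
  rw [levelCount_apply, ← Finset.prod_const]
  refine Finset.prod_congr rfl fun i hi => ?_
  rw [(Finset.mem_filter.mp hi).2]

lemma mem_support_levelCount {k : ℕ} {m : V → ℕ} {J : Finset V} :
    J ∈ (levelCount k m).support ↔ ∃ i, (1 ≤ i ∧ i ≤ k) ∧ levelSet m i = J := by
  rw [Finsupp.mem_support_iff, levelCount_apply, Finset.card_ne_zero]
  simp [Finset.Nonempty]

lemma isChain_support_levelCount (k : ℕ) (m : V → ℕ) :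
    IsChain (· ⊆ ·) ((levelCount k m).support : Set (Finset V)) := by
  intro J hJ K hK _
  rw [Finset.mem_coe, mem_support_levelCount] at hJ hK
  obtain ⟨i, _, rfl⟩ := hJ
  obtain ⟨j, _, rfl⟩ := hK
  rcases le_total i j with h | h
  · exact Or.inr (levelSet_antitone m h)
  · exact Or.inl (levelSet_antitone m h)

lemma sup_support_levelCount {k : ℕ} {m : V → ℕ} (hm : ∀ v, m v ≤ k) :
    (levelCount k m).support.sup id = levelSet m 1 := by
  ext v
  simp only [Finset.mem_sup, mem_support_levelCount, id_eq, mem_levelSet]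
  constructor
  · rintro ⟨_, ⟨i, hi, rfl⟩, hv⟩
    exact hi.1.trans (mem_levelSet.mp hv)
  · intro h
    exact ⟨_, ⟨1, ⟨le_rfl, h.trans (hm v)⟩, rfl⟩, mem_levelSet.mpr h⟩

/-- The point v lies in the level sets with index 1, …, m v and in no others; the bound by k ensures
that none of these is cut off. -/
lemma height_levelCount {k : ℕ} {m : V → ℕ} (hm : ∀ v, m v ≤ k) :
    height (levelCount k m) = m := by
  funext v
  have h : height (levelCount k m) v =
      ((Finset.Icc 1 k).filter fun i => v ∈ levelSet m i).card := by
    rw [Finset.card_eq_sum_card_fiberwise (f := levelSet m) (t := Finset.univ.filter (v ∈ ·))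
      (fun i hi => by
        rw [Finset.mem_coe, Finset.mem_filter] at hi ⊢
        exact ⟨Finset.mem_univ _, hi.2⟩)]
    refine Finset.sum_congr rfl fun J hJ => ?_
    rw [levelCount_apply, Finset.filter_filter]
    congr 1
    refine Finset.filter_congr fun i _ => ⟨fun h => ⟨h ▸ (Finset.mem_filter.mp hJ).2, h⟩, And.right⟩
  have h' : ((Finset.Icc 1 k).filter fun i => v ∈ levelSet m i) = Finset.Icc 1 (m v) := by
    ext i
    simp only [Finset.mem_filter, Finset.mem_Icc, mem_levelSet]
    have := hm v
    omega
  rw [h, h', Nat.card_Icc, Nat.add_sub_cancel]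

lemma height_le (c : Finset V →₀ ℕ) (v : V) : height c v ≤ ∑ J, c J :=
  Finset.sum_le_sum_of_subset (Finset.filter_subset _ _)

/-- With s the total multiplicity strictly above J, points of J have height at least s + c J and, by
the chain condition, all others at most s. Hence the levels s + 1, …, s + c J all equal J. -/
lemma le_levelCount_height {c : Finset V →₀ ℕ} (hc : IsChain (· ⊆ ·) (c.support : Set (Finset V)))
    (J : Finset V) : c J ≤ levelCount (∑ K, c K) (height c) J := by
  by_cases hJ : c J = 0
  · simp [hJ]
  set s := ∑ K : Finset V with J ⊂ K, c K with hs
  have hsJ : ∑ K : Finset V with J ⊆ K, c K = s + c J := by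
    have h : (Finset.univ.filter fun K : Finset V => J ⊆ K) =
        insert J (Finset.univ.filter fun K : Finset V => J ⊂ K) := by
      ext K
      simp only [Finset.mem_filter, Finset.mem_univ, true_and, Finset.mem_insert,
        Finset.ssubset_iff_subset_ne]
      constructor
      · intro h
        by_cases h' : K = J
        · exact Or.inl h'
        · exact Or.inr ⟨h, Ne.symm h'⟩
      · rintro (rfl | h)
        · exact subset_rfl
        · exact h.1
    rw [h, Finset.sum_insert (by simp), add_comm]
  have hmem : ∀ v ∈ J, s + c J ≤ height c v := fun v hv => by
    rw [← hsJ]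
    refine Finset.sum_le_sum_of_subset fun K hK => ?_
    simp only [Finset.mem_filter, Finset.mem_univ, true_and] at hK ⊢
    exact hK hv
  have hnot : ∀ v ∉ J, height c v ≤ s := fun v hv => by
    rw [hs, height, Finset.sum_filter, Finset.sum_filter]
    refine Finset.sum_le_sum fun K _ => ?_
    by_cases hK : c K = 0
    · simp [hK]
    by_cases hvK : v ∈ K
    · have hne : J ≠ K := fun h => hv (h ▸ hvK)
      have hJK : J ⊆ K := by
        rcases hc (by simpa using hJ) (by simpa using hK) hne with h | h
        · exact h
        · exact absurd (h hvK) hv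
      simp [hvK, Finset.ssubset_iff_subset_ne.mpr ⟨hJK, hne⟩]
    · simp [hvK]
  have hle : s + c J ≤ ∑ K, c K := hsJ ▸ Finset.sum_le_sum_of_subset (Finset.filter_subset _ _)
  rw [levelCount_apply]
  calc c J = (Finset.Ioc s (s + c J)).card := by simp
    _ ≤ _ := by
      refine Finset.card_le_card fun i hi => ?_
      rw [Finset.mem_Ioc] at hi
      rw [Finset.mem_filter, Finset.mem_Icc]
      refine ⟨⟨by omega, by omega⟩, ?_⟩
      ext v
      rw [mem_levelSet]
      refine ⟨fun h => ?_, fun h => hi.2.trans (hmem v h)⟩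
      by_contra hv
      have := hnot v hv
      omega

/-- Both sides have the same total, so the pointwise inequality is an equality. -/
lemma levelCount_height {c : Finset V →₀ ℕ} (hc : IsChain (· ⊆ ·) (c.support : Set (Finset V))) :
    levelCount (∑ K, c K) (height c) = c := by
  have h := (Finset.sum_eq_sum_iff_of_le fun J _ => le_levelCount_height hc J).mp
    (sum_levelCount (∑ K, c K) (height c)).symm
  ext J
  exact (h J (Finset.mem_univ J)).symm

/-- Each `gpSeries` has zero constant term, so only exponents that are positive on all of y
contribute. -/
lemma coeff_prod_gpSeries (y : Finset (Finset V)) (g : Finset V → ℚ) (k : ℕ) :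
    PowerSeries.coeff k (∏ J ∈ y, gpSeries (g J)) =
      ∑ c ∈ (Finset.univ.finsuppAntidiag k : Finset (Finset V →₀ ℕ)) with c.support = y,
        ∏ J, g J ^ c J := by
  rw [PowerSeries.coeff_prod]
  symm
  have hsub : ((Finset.univ.finsuppAntidiag k : Finset (Finset V →₀ ℕ)).filter
      fun c => c.support = y) ⊆ y.finsuppAntidiag k := by
    intro c hc
    simp only [Finset.mem_filter, Finset.mem_finsuppAntidiag] at hc ⊢
    obtain ⟨⟨hsum, -⟩, rfl⟩ := hc
    refine ⟨?_, subset_rfl⟩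
    rw [← hsum]
    exact Finset.sum_subset (Finset.subset_univ _) fun J _ hJ => by simpa using hJ
  refine (Finset.sum_congr rfl fun c hc => ?_).trans (Finset.sum_subset hsub fun c hc hc' => ?_)
  · have hy := (Finset.mem_filter.mp hc).2
    rw [← Finset.prod_subset (Finset.subset_univ y)]
    · refine Finset.prod_congr rfl fun J hJ => ?_
      rw [gpSeries, PowerSeries.coeff_mk, if_neg]
      rwa [← hy, Finsupp.mem_support_iff] at hJ
    · intro J _ hJ
      rw [← hy, Finsupp.notMem_support_iff] at hJ
      simp [hJ]
  · rw [Finset.mem_finsuppAntidiag] at hc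
    have hne : c.support ≠ y := by
      intro h
      apply hc'
      rw [Finset.mem_filter, Finset.mem_finsuppAntidiag]
      refine ⟨⟨?_, Finset.subset_univ _⟩, h⟩
      rw [← hc.1]
      exact (Finset.sum_subset (Finset.subset_univ _) fun J _ hJ => by
        rw [← h] at hJ; simpa using hJ).symm
    obtain ⟨J, hJ, hJ'⟩ := Finset.exists_of_ssubset (Finset.ssubset_iff_subset_ne.mpr ⟨hc.2, hne⟩)
    refine Finset.prod_eq_zero hJ ?_
    rw [Finsupp.notMem_support_iff] at hJ'
    simp [gpSeries, hJ']

/-- The coefficients of a generating function of flags as sums over functions `V → {0, …, k}`. -/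
theorem coeff_sum_flags (F g : Finset V → ℚ) (k : ℕ) :
    PowerSeries.coeff k (∑ y ∈ flags V, PowerSeries.C (F (y.sup id)) * ∏ J ∈ y, gpSeries (g J)) =
      ∑ m ∈ Fintype.piFinset fun _ : V => Finset.range (k + 1),
        F (levelSet m 1) * ∏ i ∈ Finset.Icc 1 k, g (levelSet m i) := by
  classical
  have h1 : PowerSeries.coeff k
      (∑ y ∈ flags V, PowerSeries.C (F (y.sup id)) * ∏ J ∈ y, gpSeries (g J)) =
      ∑ c ∈ (Finset.univ.finsuppAntidiag k : Finset (Finset V →₀ ℕ)) with c.support ∈ flags V,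
        F (c.support.sup id) * ∏ J, g J ^ c J := by
    rw [map_sum, ← Finset.sum_fiberwise_of_maps_to
      (s := (Finset.univ.finsuppAntidiag k : Finset (Finset V →₀ ℕ)).filter
        fun c => c.support ∈ flags V)
      (t := flags V) (g := fun c => c.support) (fun c hc => (Finset.mem_filter.mp hc).2)]
    refine Finset.sum_congr rfl fun y hy => ?_
    rw [PowerSeries.coeff_C_mul, coeff_prod_gpSeries, Finset.mul_sum, Finset.filter_filter]
    refine Finset.sum_congr ?_ fun c hc => ?_
    · refine Finset.filter_congr fun c _ => ⟨fun h => ⟨h ▸ hy, h⟩, And.right⟩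
    · rw [(Finset.mem_filter.mp hc).2.2]
  rw [h1]
  symm
  refine Finset.sum_nbij' (levelCount k) height ?_ ?_ ?_ ?_ ?_
  · intro m _
    simp only [Finset.mem_filter, Finset.mem_finsuppAntidiag, flags, Finset.mem_univ, true_and]
    exact ⟨⟨sum_levelCount k m, Finset.subset_univ _⟩, isChain_support_levelCount k m⟩
  · intro c hc
    simp only [Finset.mem_filter, Finset.mem_finsuppAntidiag] at hc
    simp only [Fintype.mem_piFinset, Finset.mem_range, Nat.lt_succ_iff]
    intro v
    rw [← hc.1.1]
    exact height_le c v
  · intro m hm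
    exact height_levelCount (by simpa [Nat.lt_succ_iff] using hm)
  · intro c hc
    simp only [Finset.mem_filter, Finset.mem_finsuppAntidiag, flags, Finset.mem_univ, true_and] at hc
    rw [← hc.1.1]
    exact levelCount_height hc.2
  · intro m hm
    rw [prod_pow_levelCount, sup_support_levelCount (by simpa [Nat.lt_succ_iff] using hm)]

end LevelSets

/-! ### Average sizes of kernels -/

section Average

variable {R : Type*} [CommRing R]
variable {A B C : Type*} [AddCommGroup A] [Module R A] [AddCommGroup B] [Module R B]
  [AddCommGroup C] [Module R C]

/-- The average size of the kernel is a sum of reciprocals of sizes of orbits. -/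
lemma ask_eq_sum_inv_card_range [Finite A] [Fintype B] (θ : A →ₗ[R] B →ₗ[R] C) :
    ask θ = ∑ b : B, (Nat.card (LinearMap.range (θ.flip b)) : ℚ)⁻¹ := by
  classical
  have := Fintype.ofFinite A
  have hA : (Nat.card A : ℚ) ≠ 0 := Nat.cast_ne_zero.mpr Nat.card_pos.ne'
  -- Both sides count the pairs (a, b) with θ a b = 0.
  have h : ∑ a : A, Nat.card (LinearMap.ker (θ a)) =
      ∑ b : B, Nat.card (LinearMap.ker (θ.flip b)) := by
    rw [← Nat.card_sigma, ← Nat.card_sigma]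
    exact Nat.card_congr
      { toFun := fun p => ⟨p.2.1, p.1, p.2.2⟩
        invFun := fun p => ⟨p.2.1, p.1, p.2.2⟩
        left_inv := fun _ => rfl
        right_inv := fun _ => rfl }
  rw [ask, finsum_eq_sum_of_fintype, ← Nat.cast_sum, h, Nat.cast_sum, Finset.sum_div]
  refine Finset.sum_congr rfl fun b _ => ?_
  have h1 := Submodule.card_eq_card_quotient_mul_card (LinearMap.ker (θ.flip b))
  rw [Nat.card_congr (θ.flip b).quotKerEquivRange.toEquiv] at h1
  have h2 : (Nat.card (LinearMap.ker (θ.flip b)) : ℚ) ≠ 0 :=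
    Nat.cast_ne_zero.mpr Nat.card_pos.ne'
  rw [h1, Nat.cast_mul, div_mul_cancel_left₀ h2]

lemma ask_congr {A' B' C' : Type*} [AddCommGroup A'] [Module R A'] [AddCommGroup B'] [Module R B']
    [AddCommGroup C'] [Module R C'] {θ : A →ₗ[R] B →ₗ[R] C} {θ' : A' →ₗ[R] B' →ₗ[R] C'}
    (α : A ≃ₗ[R] A') (β : B ≃ₗ[R] B') (γ : C ≃ₗ[R] C')
    (h : ∀ a b, γ (θ a b) = θ' (α a) (β b)) : ask θ = ask θ' := by
  rw [ask, ask, Nat.card_congr α.toEquiv]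
  congr 1
  refine finsum_eq_of_bijective α α.bijective fun a => ?_
  congr 1
  refine Nat.card_congr (β.toEquiv.subtypeEquiv fun b => ?_)
  change θ a b = 0 ↔ θ' (α a) (β b) = 0
  rw [← h, γ.map_eq_zero_iff]

lemma repBaseChange_tmul (S : Type*) [CommRing S] [Algebra R S] (θ : A →ₗ[R] B →ₗ[R] C)
    (s t : S) (a : A) (b : B) :
    repBaseChange S θ (s ⊗ₜ a) (t ⊗ₜ b) = (s * t) ⊗ₜ θ a b := rfl

end Average

/-! ### Orbits of incidence representations -/

section Incidence

variable {V : Type v} {E : Type w} (H : Hypergraph V E)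

lemma incidenceRep_single_apply (R : Type u) [CommRing R] (p : H.Incident) (r : R) (x : V →₀ R) :
    H.incidenceRep R (Finsupp.single p r) x = Finsupp.single p.1.2 (r * x p.1.1) := by
  simp [Hypergraph.incidenceRep]

lemma ask_repBaseChange_incidenceRep (O : Type u) (S : Type*) [CommRing O] [CommRing S]
    [Algebra O S] :
    ask (repBaseChange S (H.incidenceRep O)) = ask (H.incidenceRep S) := by
  classical
  have key : (repBaseChange S (H.incidenceRep O)).compr₂
        (TensorProduct.finsuppScalarRight O S S E).toLinearMap =
      (H.incidenceRep S).compl₁₂ (TensorProduct.finsuppScalarRight O S S H.Incident).toLinearMap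
        (TensorProduct.finsuppScalarRight O S S V).toLinearMap := by
    ext p v e
    simp [repBaseChange_tmul, incidenceRep_single_apply, TensorProduct.finsuppScalarRight_apply_tmul,
      Finsupp.single_apply]
  exact ask_congr (TensorProduct.finsuppScalarRight O S S H.Incident)
    (TensorProduct.finsuppScalarRight O S S V) (TensorProduct.finsuppScalarRight O S S E)
    fun a b => LinearMap.congr_fun₂ key a b

instance [Finite E] [Finite V] : Finite H.Incident :=
  inferInstanceAs (Finite {p : V × E // p.1 ∈ H.supp p.2})

/-- The incident pair `(v, e)` of a hyperedge `e` and a member `v` of its support. -/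
def Hypergraph.incident {e : E} (v : H.supp e) : H.Incident := ⟨(v, e), v.2⟩

variable {H} in
lemma incidenceRep_apply_apply (R : Type u) [CommRing R] (a : H.Incident →₀ R) (x : V →₀ R)
    (e : E) :
    H.incidenceRep R a x e = ∑ v : H.supp e, a (H.incident v) * x v := by
  classical
  induction a using Finsupp.induction_linear with
  | zero => simp only [map_zero, LinearMap.zero_apply, Finsupp.coe_zero, Pi.zero_apply, zero_mul,
      Finset.sum_const_zero]
  | add a b ha hb => simp only [map_add, LinearMap.add_apply, Finsupp.add_apply, ha, hb, add_mul,
      Finset.sum_add_distrib]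
  | single p r =>
    rw [incidenceRep_single_apply]
    by_cases h : p.1.2 = e
    · subst h
      rw [Finsupp.single_eq_same, Finset.sum_eq_single (⟨p.1.1, p.2⟩ : H.supp p.1.2)]
      · rw [show H.incident (⟨p.1.1, p.2⟩ : H.supp p.1.2) = p from rfl, Finsupp.single_eq_same]
      · intro w _ hw
        rw [Finsupp.single_eq_of_ne, zero_mul]
        intro h
        exact hw (Subtype.ext (congrArg (fun p : H.Incident => p.1.1) h))
      · exact fun h => absurd (Finset.mem_univ _) h
    · rw [Finsupp.single_eq_of_ne (Ne.symm h), Finset.sum_eq_zero]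
      intro w _
      rw [Finsupp.single_eq_of_ne, zero_mul]
      intro h'
      exact h (congrArg (fun p : H.Incident => p.1.2) h').symm

variable [Finite E] [Finite V]

/-- The e-coordinate involves only the entries a(v, e), and these are disjoint for different e, so
the coordinates vary independently. -/
lemma mem_range_incidenceRep_flip (R : Type u) [CommRing R] (x : V →₀ R) (y : E →₀ R) :
    y ∈ LinearMap.range ((H.incidenceRep R).flip x) ↔
      ∀ e, y e ∈ Ideal.span (Set.range fun v : H.supp e => x v) := by
  simp only [LinearMap.mem_range, LinearMap.flip_apply, Ideal.span,
    Submodule.mem_span_range_iff_exists_fun, smul_eq_mul]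
  constructor
  · rintro ⟨a, rfl⟩ e
    exact ⟨fun v => a (H.incident v), (incidenceRep_apply_apply R a x e).symm⟩
  · intro h
    choose c hc using h
    refine ⟨Finsupp.equivFunOnFinite.symm fun p : H.Incident => c p.1.2 ⟨p.1.1, p.2⟩, ?_⟩
    ext e
    rw [incidenceRep_apply_apply, ← hc]
    rfl

lemma card_range_incidenceRep_flip [Fintype E] (R : Type u) [CommRing R] (x : V →₀ R) :
    Nat.card (LinearMap.range ((H.incidenceRep R).flip x)) =
      ∏ e, Nat.card (Ideal.span (Set.range fun v : H.supp e => x v)) := by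
  rw [← Nat.card_pi]
  exact Nat.card_congr
    { toFun := fun y e => ⟨y.1 e, (mem_range_incidenceRep_flip H R x y.1).mp y.2 e⟩
      invFun := fun z => ⟨Finsupp.equivFunOnFinite.symm fun e => (z e).1,
        (mem_range_incidenceRep_flip H R x _).mpr fun e => (z e).2⟩
      left_inv := fun y => by ext; rfl
      right_inv := fun z => rfl }

lemma ask_incidenceRep [Fintype E] (R : Type u) [CommRing R] [Finite R] [Fintype (V → R)] :
    ask (H.incidenceRep R) =
      ∑ x : V → R, ∏ e, (Nat.card (Ideal.span (Set.range fun v : H.supp e => x v)) : ℚ)⁻¹ := by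
  have : Finite (H.Incident →₀ R) := Finite.of_equiv _ Finsupp.equivFunOnFinite.symm
  have : Fintype (V →₀ R) := Fintype.ofEquiv _ Finsupp.equivFunOnFinite.symm
  rw [ask_eq_sum_inv_card_range]
  refine Fintype.sum_equiv Finsupp.equivFunOnFinite _ _ fun x => ?_
  rw [card_range_incidenceRep_flip, Nat.cast_prod, Finset.prod_inv_distrib]
  rfl

end Incidence

/-! ### Finite chain rings -/

section ChainRing

/-- A finite ring whose principal ideals form a chain `I 0 ⊂ I 1 ⊂ ⋯ ⊂ I k` with `#(I j) = q ^ j`. -/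
structure IsChainOfIdeals (q k : ℕ) {R : Type*} [CommRing R] (I : ℕ → Ideal R) : Prop where
  monotone : Monotone I
  card_eq : ∀ j ≤ k, Nat.card (I j) = q ^ j
  exists_span_eq : ∀ x : R, ∃ j ≤ k, Ideal.span {x} = I j

namespace IsChainOfIdeals

variable {q k : ℕ} {R : Type*} [CommRing R] {I : ℕ → Ideal R} (hI : IsChainOfIdeals q k I)
include hI

/-- The index of the ideal generated by an element. -/
def depth (x : R) : ℕ := (hI.exists_span_eq x).choose

lemma depth_le (x : R) : hI.depth x ≤ k := (hI.exists_span_eq x).choose_spec.1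

lemma span_eq (x : R) : Ideal.span {x} = I (hI.depth x) := (hI.exists_span_eq x).choose_spec.2

lemma mem_iff [Finite R] (hq : 1 < q) {x : R} {j : ℕ} (hj : j ≤ k) : x ∈ I j ↔ hI.depth x ≤ j := by
  rw [← Ideal.span_singleton_le_iff_mem, hI.span_eq]
  refine ⟨fun h => ?_, fun h => hI.monotone h⟩
  have := Nat.card_mono (Set.toFinite (I j : Set R)) h
  change Nat.card (I (hI.depth x)) ≤ Nat.card (I j) at this
  rw [hI.card_eq _ (hI.depth_le x), hI.card_eq j hj] at this
  exact (Nat.pow_le_pow_iff_right hq).mp this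

lemma card_depth_le [Fintype R] (hq : 1 < q) {j : ℕ} (hj : j ≤ k) :
    (Finset.univ.filter fun x => hI.depth x ≤ j).card = q ^ j := by
  rw [← hI.card_eq j hj, ← Nat.subtype_card]
  intro x
  rw [Finset.mem_filter, hI.mem_iff hq hj]
  simp

/-- For j ≥ 1 the count is q^j − q^(j−1); only zero has depth 0. -/
lemma card_depth_eq [Fintype R] (hq : 1 < q) {j : ℕ} (hj : j ≤ k) :
    ((Finset.univ.filter fun x => hI.depth x = j).card : ℚ) =
      (if 1 ≤ j then 1 - (q : ℚ)⁻¹ else 1) * (q : ℚ) ^ j := by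
  classical
  cases j with
  | zero => simpa using congrArg (Nat.cast (R := ℚ)) (hI.card_depth_le hq hj)
  | succ j =>
    have h1 := hI.card_depth_le hq hj
    have h2 := hI.card_depth_le hq (Nat.le_of_succ_le hj)
    have h3 : (Finset.univ.filter fun x => hI.depth x ≤ j + 1) =
        (Finset.univ.filter fun x => hI.depth x ≤ j) ∪
          Finset.univ.filter fun x => hI.depth x = j + 1 := by
      ext x
      simp only [Finset.mem_union, Finset.mem_filter, Finset.mem_univ, true_and]
      omega
    rw [h3, Finset.card_union_of_disjoint, h2] at h1
    · have h4 := congrArg (Nat.cast (R := ℚ)) h1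
      push_cast at h4
      have hq0 : (q : ℚ) ≠ 0 := by positivity
      rw [if_pos (by omega)]
      have h5 : (q : ℚ)⁻¹ * (q : ℚ) ^ (j + 1) = (q : ℚ) ^ j := by
        rw [pow_succ', inv_mul_cancel_left₀ hq0]
      linear_combination h4 + h5
    · rw [Finset.disjoint_filter]
      intro x _
      omega

lemma card_depth_comp_eq {V : Type*} [Fintype V] [DecidableEq V] [Fintype R] (hq : 1 < q)
    {m : V → ℕ} (hm : ∀ v, m v ≤ k) :
    ((Finset.univ.filter fun x : V → R => (fun v => hI.depth (x v)) = m).card : ℚ) =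
      (1 - (q : ℚ)⁻¹) ^ (levelSet m 1).card * (q : ℚ) ^ ∑ v, m v := by
  classical
  have h : (Finset.univ.filter fun x : V → R => (fun v => hI.depth (x v)) = m) =
      Fintype.piFinset fun v => Finset.univ.filter fun r => hI.depth r = m v := by
    ext x
    simp [funext_iff]
  rw [h, Fintype.card_piFinset, Nat.cast_prod]
  simp only [fun v => hI.card_depth_eq hq (hm v)]
  rw [Finset.prod_mul_distrib, Finset.prod_pow_eq_pow_sum, Finset.prod_ite, Finset.prod_const,
    Finset.prod_const_one, mul_one]
  rfl

lemma card_span {ι : Type*} (s : Finset ι) (x : ι → R) :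
    Nat.card (Ideal.span (Set.range fun v : s => x v)) = q ^ s.sup fun v => hI.depth (x v) := by
  have h : Ideal.span (Set.range fun v : s => x v) = I (s.sup fun v => hI.depth (x v)) := by
    apply le_antisymm
    · rw [Ideal.span_le]
      rintro _ ⟨v, rfl⟩
      refine hI.monotone (Finset.le_sup (f := fun v => hI.depth (x v)) v.2) ?_
      rw [← hI.span_eq]
      exact Ideal.mem_span_singleton_self _
    · rcases s.eq_empty_or_nonempty with rfl | hs
      -- An empty support generates the zero ideal, which is I 0 because I 0 has one element.
      · have h1 := hI.card_eq 0 (Nat.zero_le k)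
        rw [pow_zero, Nat.card_eq_one_iff_unique] at h1
        have := h1.1
        rw [Finset.sup_empty, bot_eq_zero, Submodule.eq_bot_of_subsingleton (p := I 0)]
        exact bot_le
      · obtain ⟨v, hv, h⟩ := Finset.exists_mem_eq_sup s hs fun v => hI.depth (x v)
        rw [h, ← hI.span_eq]
        exact Ideal.span_mono (Set.singleton_subset_iff.mpr ⟨⟨v, hv⟩, rfl⟩)
  rw [h, hI.card_eq _ (Finset.sup_le fun v _ => hI.depth_le _)]

end IsChainOfIdeals

/-! ### Sums and maxima as sums over level sets -/

section LevelSums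

variable {V : Type v} [Fintype V] {k : ℕ} {m : V → ℕ}

lemma sum_eq_sum_card_levelSet (hm : ∀ v, m v ≤ k) :
    ∑ v, m v = ∑ i ∈ Finset.Icc 1 k, (levelSet m i).card := by
  simp only [levelSet, Finset.card_filter]
  rw [Finset.sum_comm]
  refine Finset.sum_congr rfl fun v _ => ?_
  rw [← Finset.card_filter]
  have h : ((Finset.Icc 1 k).filter fun i => i ≤ m v) = Finset.Icc 1 (m v) := by
    ext i
    have := hm v
    simp only [Finset.mem_filter, Finset.mem_Icc]
    omega
  rw [h, Nat.card_Icc, Nat.add_sub_cancel]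

lemma sup_eq_card_filter_levelSet [DecidableEq V] (hm : ∀ v, m v ≤ k) (s : Finset V) :
    s.sup m = ((Finset.Icc 1 k).filter fun i => (s ∩ levelSet m i).Nonempty).card := by
  have h : ((Finset.Icc 1 k).filter fun i => (s ∩ levelSet m i).Nonempty) =
      Finset.Icc 1 (s.sup m) := by
    ext i
    have hk : s.sup m ≤ k := Finset.sup_le fun v _ => hm v
    simp only [Finset.mem_filter, Finset.mem_Icc, Finset.Nonempty, Finset.mem_inter, mem_levelSet]
    constructor
    · rintro ⟨hi, v, hv, h⟩
      exact ⟨hi.1, h.trans (Finset.le_sup hv)⟩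
    · rintro ⟨h1, h2⟩
      exact ⟨⟨h1, h2.trans hk⟩, (Finset.le_sup_iff (Nat.lt_of_succ_le h1)).mp h2⟩
  rw [h, Nat.card_Icc, Nat.add_sub_cancel]

lemma sum_sup_eq_sum_card [DecidableEq V] {E : Type w} [Fintype E] (s : E → Finset V)
    (hm : ∀ v, m v ≤ k) :
    ∑ e, (s e).sup m =
      ∑ i ∈ Finset.Icc 1 k, (Finset.univ.filter fun e => (s e ∩ levelSet m i).Nonempty).card := by
  simp only [sup_eq_card_filter_levelSet hm, Finset.card_filter]
  exact Finset.sum_comm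

end LevelSums

theorem IsChainOfIdeals.ask_incidenceRep {q k : ℕ} {R : Type u} [CommRing R] [Finite R]
    {I : ℕ → Ideal R} (hI : IsChainOfIdeals q k I) (hq : 1 < q)
    {V : Type v} [Fintype V] [DecidableEq V] {E : Type w} [Fintype E] (H : Hypergraph V E) :
    ask (H.incidenceRep R) =
      ∑ m ∈ Fintype.piFinset fun _ : V => Finset.range (k + 1),
        (1 - (q : ℚ)⁻¹) ^ (levelSet m 1).card *
          ∏ i ∈ Finset.Icc 1 k, (q : ℚ) ^ (((levelSet m i).card : ℤ) -
            (Finset.univ.filter fun e => (H.supp e ∩ levelSet m i).Nonempty).card) := by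
  classical
  have := Fintype.ofFinite R
  have hq0 : (q : ℚ) ≠ 0 := by positivity
  rw [AskZeta.ask_incidenceRep, ← Finset.sum_fiberwise_of_maps_to
    (t := Fintype.piFinset fun _ : V => Finset.range (k + 1))
    (g := fun (x : V → R) v => hI.depth (x v))]
  · refine Finset.sum_congr rfl fun m hm => ?_
    have hm : ∀ v, m v ≤ k := by simpa [Nat.lt_succ_iff] using hm
    rw [Finset.sum_congr rfl (g := fun _ => ((q : ℚ) ^ ∑ e, (H.supp e).sup m)⁻¹),
      Finset.sum_const, nsmul_eq_mul, hI.card_depth_comp_eq hq hm, mul_assoc,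
      sum_eq_sum_card_levelSet hm, sum_sup_eq_sum_card H.supp hm]
    · simp only [zpow_sub₀ hq0, zpow_natCast]
      rw [Finset.prod_div_distrib, Finset.prod_pow_eq_pow_sum, Finset.prod_pow_eq_pow_sum,
        div_eq_mul_inv]
    · intro x hx
      have hx := (Finset.mem_filter.mp hx).2
      rw [← Finset.prod_pow_eq_pow_sum, ← Finset.prod_inv_distrib]
      refine Finset.prod_congr rfl fun e _ => ?_
      rw [hI.card_span, ← hx, Nat.cast_pow]
  · intro x _
    rw [Fintype.mem_piFinset]
    exact fun v => Finset.mem_range.mpr (Nat.lt_succ_of_le (hI.depth_le _))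

end ChainRing

/-! ### Quotients of discrete valuation rings -/

section DVR

open IsLocalRing

variable (O : Type u) [CommRing O] [IsDomain O] [IsDiscreteValuationRing O]

lemma card_quotient_maximalIdeal_pow (k : ℕ) :
    Nat.card (O ⧸ maximalIdeal O ^ k) = Nat.card (ResidueField O) ^ k :=
  cardQuot_pow_of_prime (IsDiscreteValuationRing.not_a_field O)

/-- The exponent is reversed so that the j-th ideal, 𝔓^(k−j)/𝔓^k, has q^j elements. This follows by
dividing |𝔒/𝔓^k| by |𝔒/𝔓^(k−j)|. -/
lemma isChainOfIdeals_quotient [Finite (ResidueField O)] (k : ℕ) :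
    IsChainOfIdeals (Nat.card (ResidueField O)) k fun j =>
      (maximalIdeal O ^ (k - j)).map (Ideal.Quotient.mk (maximalIdeal O ^ k)) where
  monotone i j hij := Ideal.map_mono (Ideal.pow_le_pow_right (by omega))
  card_eq j hj := by
    have h := Submodule.card_eq_card_quotient_mul_card
      ((maximalIdeal O ^ (k - j)).map (Ideal.Quotient.mk (maximalIdeal O ^ k)))
    have hle : maximalIdeal O ^ k ≤ maximalIdeal O ^ (k - j) :=
      Ideal.pow_le_pow_right (Nat.sub_le k j)
    have h' := Nat.card_congr (DoubleQuot.quotQuotEquivQuotOfLE hle).toEquiv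
    rw [card_quotient_maximalIdeal_pow] at h h'
    have h'' : Nat.card (ResidueField O) ^ k =
        Nat.card (ResidueField O) ^ j * Nat.card (ResidueField O) ^ (k - j) := by
      rw [← pow_add, Nat.add_sub_cancel' hj]
    have h3 := h.symm.trans h''
    erw [h'] at h3
    exact Nat.eq_of_mul_eq_mul_right (pow_pos Nat.card_pos _) h3
  exists_span_eq x := by
    obtain ⟨a, rfl⟩ := Ideal.Quotient.mk_surjective x
    obtain ⟨ϖ, hϖ⟩ := IsDiscreteValuationRing.exists_irreducible O
    have hmap : ∀ n ≤ k, ∃ j ≤ k, Ideal.map (Ideal.Quotient.mk (maximalIdeal O ^ k))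
        (maximalIdeal O ^ n) = Ideal.map (Ideal.Quotient.mk (maximalIdeal O ^ k))
        (maximalIdeal O ^ (k - j)) := fun n hn =>
      ⟨k - n, Nat.sub_le k n, by rw [Nat.sub_sub_self hn]⟩
    -- Zero is treated apart, as the image of 𝔓^k, since a itself may be 0 and have no finite
    -- valuation.
    by_cases ha : Ideal.Quotient.mk (maximalIdeal O ^ k) a = 0
    · obtain ⟨j, hj, h⟩ := hmap k le_rfl
      exact ⟨j, hj, by rw [← h, ha, Ideal.map_quotient_self]; simp⟩
    · have ha0 : a ≠ 0 := fun h => ha (by rw [h, map_zero])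
      obtain ⟨n, hn⟩ := IsDiscreteValuationRing.associated_pow_irreducible ha0 hϖ
      have hspan : Ideal.span {a} = maximalIdeal O ^ n := by
        rw [Ideal.span_singleton_eq_span_singleton.mpr hn, hϖ.maximalIdeal_eq,
          Ideal.span_singleton_pow]
      have hnk : n ≤ k := by
        by_contra h
        apply ha
        rw [Ideal.Quotient.eq_zero_iff_mem, ← Ideal.span_singleton_le_iff_mem, hspan]
        exact Ideal.pow_le_pow_right (by omega)
      obtain ⟨j, hj, h⟩ := hmap n hnk
      exact ⟨j, hj, by rw [← h, ← hspan, Ideal.map_span, Set.image_singleton]⟩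

/-- The maximal ideal is an open subgroup of a compact group, so it has finite index. -/
lemma finite_residueField_of_isAdic [TopologicalSpace O] [CompactSpace O]
    (h : IsAdic (maximalIdeal O)) : Finite (ResidueField O) := by
  have h2 : IsTopologicalRing O := by
    have h' : _ = _ := h
    rw [h']
    exact (maximalIdeal O).nonarchimedean.toIsTopologicalRing
  have h1 : IsOpen (maximalIdeal O : Set O) := by simpa using (isAdic_iff.mp h).1 1
  exact AddSubgroup.quotient_finite_of_isOpen (maximalIdeal O).toAddSubgroup h1

end DVR

/-! ### Compact discrete valuation rings with given residue field sizes -/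

section Padic

open IsLocalRing

/-- The powers of 𝔓 are closed and, by Krull's theorem, meet in 0. By compactness, one of them lies
in any given neighbourhood of 0. -/
lemma isAdic_maximalIdeal (O : Type u) [CommRing O] [IsLocalRing O] [IsNoetherianRing O]
    [TopologicalSpace O] [IsTopologicalRing O] [CompactSpace O] [T2Space O] :
    IsAdic (maximalIdeal O) := by
  rw [isAdic_iff]
  refine ⟨isOpen_maximalIdeal_pow O, fun s hs => ?_⟩
  refine exists_subset_nhds_of_compactSpace (V := fun n => ((maximalIdeal O ^ n : Ideal O) : Set O))
    ?_ (fun n => (maximalIdeal O ^ n).toAddSubgroup.isClosed_of_isOpen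
      (isOpen_maximalIdeal_pow O n)) fun x hx => ?_
  · exact directed_of_isDirected_le fun i j hij => Ideal.pow_le_pow_right hij
  · have h0 : x ∈ ⨅ n, maximalIdeal O ^ n := by simpa using hx
    rw [Ideal.iInf_pow_eq_bot_of_isLocalRing _ (Ideal.IsPrime.ne_top'), Ideal.mem_bot] at h0
    rwa [h0]

variable (p : ℕ) [Fact p.Prime]

-- The lift puts the p-adic integers in the universe over which `IsAskZetaFunction` quantifies.
instance : IsDomain (ULift.{u} ℤ_[p]) := ULift.ringEquiv.toMulEquiv.isDomain _

instance : IsDiscreteValuationRing (ULift.{u} ℤ_[p]) :=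
  IsDiscreteValuationRing.RingEquivClass.isDiscreteValuationRing (ULift.ringEquiv (R := ℤ_[p])).symm

instance : IsTopologicalRing (ULift.{u} ℤ_[p]) where
  continuous_add := by
    exact continuous_uliftUp.comp ((continuous_uliftDown.comp continuous_fst).add
      (continuous_uliftDown.comp continuous_snd))
  continuous_mul := by
    exact continuous_uliftUp.comp ((continuous_uliftDown.comp continuous_fst).mul
      (continuous_uliftDown.comp continuous_snd))
  continuous_neg := continuous_uliftUp.comp continuous_uliftDown.neg

instance : CompactSpace (ULift.{u} ℤ_[p]) := Homeomorph.ulift.symm.compactSpace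

instance : T2Space (ULift.{u} ℤ_[p]) := Homeomorph.ulift.symm.t2Space

lemma card_residueField_ulift_padicInt : Nat.card (ResidueField (ULift.{u} ℤ_[p])) = p := by
  rw [Nat.card_congr (ResidueField.mapEquiv (ULift.ringEquiv (R := ℤ_[p]))).toEquiv,
    Nat.card_congr PadicInt.residueField.toEquiv, Nat.card_zmod]

lemma Hypergraph.IsAskZetaFunction.eq {V : Type v} {E : Type w} {H : Hypergraph V E}
    {W W' : RatFun2} (h : Hypergraph.IsAskZetaFunction.{u} H W)
    (h' : Hypergraph.IsAskZetaFunction.{u} H W') : W = W' := by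
  have hS : ((fun n : ℕ => (n : ℚ)) '' {p | p.Prime}).Infinite :=
    Nat.infinite_setOfPred_prime.image Nat.cast_injective.injOn
  refine eq_of_specializesTo hS ?_
  rintro _ ⟨p, hp, rfl⟩
  have : Fact p.Prime := ⟨hp⟩
  have h1 := h (ULift.{u} ℤ_[p]) (isAdic_maximalIdeal _)
  have h2 := h' (ULift.{u} ℤ_[p]) (isAdic_maximalIdeal _)
  rw [card_residueField_ulift_padicInt] at h1 h2
  exact ⟨_, h1, h2⟩

end Padic

/-! ### The ask zeta function of a hypergraph -/

section Main

variable {V : Type v} {E : Type w} [Fintype V] [DecidableEq V]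

lemma sum_multiplicity_eq_card [Fintype E] (H : Hypergraph V E) (J : Finset V) :
    ∑ I : Finset V with (I ∩ J).Nonempty, H.multiplicity I =
      (Finset.univ.filter fun e => (H.supp e ∩ J).Nonempty).card := by
  classical
  rw [Finset.card_eq_sum_card_fiberwise (f := H.supp)
    (t := Finset.univ.filter fun I : Finset V => (I ∩ J).Nonempty) (fun e he => by simpa using he)]
  refine Finset.sum_congr rfl fun I hI => ?_
  rw [Hypergraph.multiplicity, Finset.filter_filter, Nat.subtype_card]
  intro e
  simp only [Finset.mem_filter, Finset.mem_univ, true_and] at hI ⊢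
  exact ⟨And.right, fun h => ⟨h ▸ hI, h⟩⟩

lemma isAskZetaFunction_sum_flags [Finite E] (H : Hypergraph V E) :
    Hypergraph.IsAskZetaFunction.{u} H
      (∑ y ∈ flags V, (1 - varX⁻¹) ^ flagRank y * ∏ J ∈ y, gp
        (varX ^ ((J.card : ℤ) - ∑ I : Finset V with (I ∩ J).Nonempty, (H.multiplicity I : ℤ)) *
          varT)) := by
  intro O _ _ _ _ _ hO
  have := Fintype.ofFinite E
  have := finite_residueField_of_isAdic O hO
  set q := Nat.card (IsLocalRing.ResidueField O) with hq
  have hq1 : 1 < q := Finite.one_lt_card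
  have hq0 : (q : ℚ) ≠ 0 := by positivity
  -- The formula is proved for power series at the fixed q, one coefficient at a time, and only then
  -- lifted to ℚ(X, T).
  have hZ : askZeta (H.incidenceRep O) = ∑ y ∈ flags V,
      PowerSeries.C ((1 - (q : ℚ)⁻¹) ^ (y.sup id).card) * ∏ J ∈ y, gpSeries ((q : ℚ) ^
        ((J.card : ℤ) - (Finset.univ.filter fun e => (H.supp e ∩ J).Nonempty).card)) := by
    ext k
    have : Finite (O ⧸ IsLocalRing.maximalIdeal O ^ k) := by
      apply Nat.finite_of_card_ne_zero
      rw [card_quotient_maximalIdeal_pow]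
      positivity
    rw [coeff_sum_flags (fun J => (1 - (q : ℚ)⁻¹) ^ J.card), askZeta, PowerSeries.coeff_mk,
      ask_repBaseChange_incidenceRep, (isChainOfIdeals_quotient O k).ask_incidenceRep hq1]
  rw [hZ]
  refine SpecializesTo.sum _ fun y _ => SpecializesTo.mul ?_ (SpecializesTo.prod _ fun J _ => ?_)
  · simpa [flagRank] using (SpecializesTo.one.sub (specializesTo_varX_inv hq0)).pow (y.sup id).card
  · rw [← Nat.cast_sum, sum_multiplicity_eq_card]
    exact specializesTo_gp_varX_zpow_mul_varT hq0 _

end Main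

end

end AskZeta

/-- The backward implication is existence together with the formula; the forward one is uniqueness.
-/
theorem mainTheorem4 {V : Type v} {E : Type w} [Fintype V] [DecidableEq V] [Finite E]
    (H : AskZeta.Hypergraph V E) (μ : Finset V → ℕ) (hμ : ∀ I : Finset V, H.multiplicity I = μ I)
    (W : AskZeta.RatFun2) :
    AskZeta.Hypergraph.IsAskZetaFunction.{u} H W ↔
      W = ∑ y ∈ AskZeta.flags V, (1 - AskZeta.varX⁻¹) ^ AskZeta.flagRank y *
        ∏ J ∈ y, AskZeta.gp
          (AskZeta.varX ^ ((J.card : ℤ) - ∑ I : Finset V with (I ∩ J).Nonempty, (μ I : ℤ)) *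
            AskZeta.varT) := by
  obtain rfl : H.multiplicity = μ := funext hμ
  have h := AskZeta.isAskZetaFunction_sum_flags.{u} H
  exact ⟨fun hW => hW.eq h, fun hW => hW ▸ h⟩
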